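/- Let $\Bbbk$ be a field and let $A$ be a $\Bbbk$-algebra with zero multiplication ($A^2=0$). Let $X$ be a linear basis of $A$ equipped with a well order $\le$. Let $X^{**}$ be the set of nonempty nonassociative words in the alphabet $X$, and let $M\langle X\rangle$ be the free nonassociative $\Bbbk$-algebra generated by $X$, so that $X^{**}$ is its linear basis. Order $X^{**}$ by comparing weights lexicographically, where $\mathrm{wt}(x)=(1,x)$ for $x\in X$ and $\mathrm{wt}(u_1u_2)=(|u_1u_2|,u_2,u_1)$, with $|u|$ the length of $u$. For a monic $f\in M\langle X\rangle$ let $\bar f$ be its leading monomial. For a word $u$ in $X\cup\{\star\}$ in which $\star$ occurs exactly once, let $u|_{\star=f}$ be the result of substituting $f$ for $\star$. A set $S\subseteq M\langle X\rangle$ of monic polynomials is a *Gröbner–Shirshov basis* if for all $f,g\in S$ and every such $u$ with $\bar f=u|_{\star=\bar g}$, the polynomial $f-u|_{\star=g}$ is a linear combination of finitely many polynomials $u_i|_{\star=s_i}$ with $s_i\in S$ and $u_i|_{\star=\bar s_i}<\bar f$. A *Zinbiel* (pre-commutative) algebra is an algebra satisfying $a(bc)=(ab)c+(ba)c$. For a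 Zinbiel algebra $Z$ let $Z^{(+)}$ be the same space with the commutative product $ab+ba$. Let $\iota:A\to U_{(+)}(A)^{(+)}$ be the universal homomorphism from $A$ to an algebra of the form $Z^{(+)}$, with $Z$ Zinbiel; that is, $U_{(+)}$ is the left adjoint of $Z\mapsto Z^{(+)}$. Let $S\subset M\langle X\rangle$ be the set of the following polynomials: - $a(bc)-(ab)c-(ba)c$ for $a,b,c\in X^{**}$; - $xy+yx$ for $x,y\in X$, $x<y$; - $xx$ for $x\in X$; - $(ax)y+(ay)x$ for $x,y\in X$, $x<y$, and $a\in X^{**}$ of even length; - $(ax)x$ for $x\in X$ and $a\in X^{**}$ of even length. **Theorem.** $S$ is a Gröbner–Shirshov basis in $M\langle X\rangle$. If moreover the characteristic of $\Bbbk$ is not $2$, then $S$ is a Gröbner–Shirshov basis of $U_{(+)}(A)$: the algebra homomorphism $M\langle X\rangle\to U_{(+)}(A)$, $x\mapsto\iota(x)$ for $x\in X$, is surjective and its kernel is the ideal generated by $S$, so that $U_{(+)}(A)\cong M\langle X\mid S\rangle$. -/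

import Mathlib

noncomputable section

namespace PreCom

/-! ### Quotient of a (nonassociative, nonunital) algebra by the ideal generated by a set -/

section Quotient

variable (k : Type*) {M : Type*} [Field k] [NonUnitalNonAssocRing M] [Module k M]

/-- The two-sided ideal `I(S)` (of the `k`-algebra `M`) generated by `S`: the smallest subspace
containing `S` and closed under left and right multiplication by all elements of `M`. -/
def idealSpan (S : Set M) : Submodule k M :=
  sInf {p : Submodule k M | S ⊆ p ∧ ∀ a : M, ∀ f ∈ p, a * f ∈ p ∧ f * a ∈ p}

theorem subset_idealSpan (S : Set M) : S ⊆ idealSpan k S := by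
  intro s hs
  simp only [idealSpan, SetLike.mem_coe, Submodule.mem_sInf, Set.mem_ofPred_eq]
  exact fun p hp => hp.1 hs

theorem idealSpan_le {S : Set M} {p : Submodule k M} (h : S ⊆ p)
    (h' : ∀ a : M, ∀ f ∈ p, a * f ∈ p ∧ f * a ∈ p) : idealSpan k S ≤ p :=
  sInf_le ⟨h, h'⟩

theorem mul_mem_idealSpan {S : Set M} (a : M) {f : M} (hf : f ∈ idealSpan k S) :
    a * f ∈ idealSpan k S ∧ f * a ∈ idealSpan k S := by
  simp only [idealSpan, Submodule.mem_sInf, Set.mem_ofPred_eq] at hf ⊢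
  exact ⟨fun p hp => (hp.2 a f (hf p hp)).1, fun p hp => (hp.2 a f (hf p hp)).2⟩

/-- The quotient algebra `M / I(S)`. -/
def AlgQuot (S : Set M) : Type _ := M ⧸ idealSpan k S

variable {S : Set M}

instance : AddCommGroup (AlgQuot k S) := inferInstanceAs (AddCommGroup (M ⧸ idealSpan k S))

instance : Module k (AlgQuot k S) := inferInstanceAs (Module k (M ⧸ idealSpan k S))

/-- The projection `M → M / I(S)`. -/
def AlgQuot.mk (S : Set M) : M →ₗ[k] AlgQuot k S := (idealSpan k S).mkQ

theorem AlgQuot.mk_surjective : Function.Surjective (AlgQuot.mk k S) :=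
  Submodule.mkQ_surjective _

theorem AlgQuot.mk_eq_zero {f : M} : AlgQuot.mk k S f = 0 ↔ f ∈ idealSpan k S :=
  Submodule.Quotient.mk_eq_zero _

theorem AlgQuot.mk_eq {f g : M} : AlgQuot.mk k S f = AlgQuot.mk k S g ↔ f - g ∈ idealSpan k S :=
  Submodule.Quotient.eq _

instance : Mul (AlgQuot k S) where
  mul := Quotient.map₂ (· * ·) (by
    intro a b hab c d hcd
    have hab : a - b ∈ idealSpan k S := (Submodule.quotientRel_def _).1 hab
    have hcd : c - d ∈ idealSpan k S := (Submodule.quotientRel_def _).1 hcd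
    refine (Submodule.quotientRel_def _).2 ?_
    have h : a * c - b * d = (a - b) * c + b * (c - d) := by rw [sub_mul, mul_sub]; abel
    rw [h]
    exact add_mem (mul_mem_idealSpan k c hab).2 (mul_mem_idealSpan k b hcd).1)

theorem AlgQuot.mk_mul (f g : M) :
    AlgQuot.mk k S (f * g) = AlgQuot.mk k S f * AlgQuot.mk k S g := rfl

instance : NonUnitalNonAssocRing (AlgQuot k S) where
  left_distrib a b c := by
    obtain ⟨a, rfl⟩ := AlgQuot.mk_surjective k a
    obtain ⟨b, rfl⟩ := AlgQuot.mk_surjective k b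
    obtain ⟨c, rfl⟩ := AlgQuot.mk_surjective k c
    simp only [← AlgQuot.mk_mul, ← map_add, mul_add]
  right_distrib a b c := by
    obtain ⟨a, rfl⟩ := AlgQuot.mk_surjective k a
    obtain ⟨b, rfl⟩ := AlgQuot.mk_surjective k b
    obtain ⟨c, rfl⟩ := AlgQuot.mk_surjective k c
    simp only [← AlgQuot.mk_mul, ← map_add, add_mul]
  zero_mul a := by
    obtain ⟨a, rfl⟩ := AlgQuot.mk_surjective k a
    rw [← map_zero (AlgQuot.mk k S), ← AlgQuot.mk_mul, zero_mul]
  mul_zero a := by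
    obtain ⟨a, rfl⟩ := AlgQuot.mk_surjective k a
    rw [← map_zero (AlgQuot.mk k S), ← AlgQuot.mk_mul, mul_zero]

instance [IsScalarTower k M M] : IsScalarTower k (AlgQuot k S) (AlgQuot k S) where
  smul_assoc c a b := by
    obtain ⟨a, rfl⟩ := AlgQuot.mk_surjective k a
    obtain ⟨b, rfl⟩ := AlgQuot.mk_surjective k b
    simp only [smul_eq_mul, ← AlgQuot.mk_mul, ← map_smul, smul_mul_assoc]

instance [SMulCommClass k M M] : SMulCommClass k (AlgQuot k S) (AlgQuot k S) where
  smul_comm c a b := by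
    obtain ⟨a, rfl⟩ := AlgQuot.mk_surjective k a
    obtain ⟨b, rfl⟩ := AlgQuot.mk_surjective k b
    simp only [smul_eq_mul, ← AlgQuot.mk_mul, ← map_smul, mul_smul_comm]

end Quotient

/-! ### The universal enveloping pre-commutative (Zinbiel) algebra `U_{(+)}(A)` -/

/-- The Zinbiel (pre-commutative) identity `a(bc) = (ab)c + (ba)c`. -/
def IsZinbiel (Z : Type*) [NonUnitalNonAssocRing Z] : Prop :=
  ∀ a b c : Z, a * (b * c) = (a * b) * c + (b * a) * c

section Envelope

variable (k : Type*) (A : Type*) [Field k] [NonUnitalCommRing A] [Module k A]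

open FreeNonUnitalNonAssocAlgebra in
/-- Defining relations of `U_{(+)}(A)` on the generators `of a`, `a ∈ A`: the Zinbiel identity,
linearity of `a ↦ of a`, and `of a * of b + of b * of a = of (a * b)`. -/
inductive EnvRel : FreeNonUnitalNonAssocAlgebra k A → Prop
  | zinbiel (f g h : FreeNonUnitalNonAssocAlgebra k A) :
      EnvRel (f * (g * h) - (f * g) * h - (g * f) * h)
  | add (a b : A) : EnvRel (of k (a + b) - of k a - of k b)
  | smul (c : k) (a : A) : EnvRel (of k (c • a) - c • of k a)
  | anticomm (a b : A) : EnvRel (of k a * of k b + of k b * of k a - of k (a * b))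

/-- The universal enveloping pre-commutative algebra `U_{(+)}(A)` of a commutative algebra `A`:
the value at `A` of the left adjoint of the functor `Z ↦ Z^{(+)}` from Zinbiel algebras to
commutative algebras, where `Z^{(+)}` is `Z` with the product `ab + ba`. -/
abbrev Envelope : Type _ := AlgQuot k {f : FreeNonUnitalNonAssocAlgebra k A | EnvRel k A f}

theorem Envelope.isZinbiel : IsZinbiel (Envelope k A) := by
  intro a b c
  obtain ⟨a, rfl⟩ := AlgQuot.mk_surjective k a
  obtain ⟨b, rfl⟩ := AlgQuot.mk_surjective k b
  obtain ⟨c, rfl⟩ := AlgQuot.mk_surjective k c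
  simp only [← AlgQuot.mk_mul, ← map_add]
  rw [AlgQuot.mk_eq, ← sub_sub]
  exact subset_idealSpan k _ (EnvRel.zinbiel a b c)

/-- The canonical linear map `A → U_{(+)}(A)`. -/
def Envelope.ι : A →ₗ[k] Envelope k A where
  toFun a := AlgQuot.mk k _ (FreeNonUnitalNonAssocAlgebra.of k a)
  map_add' a b := by
    rw [← map_add, AlgQuot.mk_eq, ← sub_sub]
    exact subset_idealSpan k _ (EnvRel.add a b)
  map_smul' c a := by
    rw [RingHom.id_apply, ← map_smul, AlgQuot.mk_eq]
    exact subset_idealSpan k _ (EnvRel.smul c a)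

/-- The canonical map is a homomorphism `A → U_{(+)}(A)^{(+)}`. -/
theorem Envelope.ι_mul (a b : A) :
    Envelope.ι k A (a * b) =
      Envelope.ι k A a * Envelope.ι k A b + Envelope.ι k A b * Envelope.ι k A a := by
  symm
  change AlgQuot.mk k _ _ * AlgQuot.mk k _ _ + AlgQuot.mk k _ _ * AlgQuot.mk k _ _ =
    AlgQuot.mk k _ _
  simp only [← AlgQuot.mk_mul, ← map_add]
  rw [AlgQuot.mk_eq]
  exact subset_idealSpan k _ (EnvRel.anticomm a b)

/-- The universal property: every homomorphism of commutative algebras `A → Z^{(+)}`, with `Z`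
a Zinbiel algebra, factors uniquely through a homomorphism `U_{(+)}(A) → Z`. -/
theorem Envelope.existsUnique_lift {Z : Type*} [NonUnitalNonAssocRing Z] [Module k Z]
    [IsScalarTower k Z Z] [SMulCommClass k Z Z] (hZ : IsZinbiel Z) (φ : A →ₗ[k] Z)
    (hφ : ∀ a b : A, φ (a * b) = φ a * φ b + φ b * φ a) :
    ∃! ψ : Envelope k A →ₙₐ[k] Z, ∀ a : A, ψ (Envelope.ι k A a) = φ a := by
  let F := FreeNonUnitalNonAssocAlgebra.lift k (φ : A → Z)
  have hof : ∀ a, F (FreeNonUnitalNonAssocAlgebra.of k a) = φ a :=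
    FreeNonUnitalNonAssocAlgebra.lift_of_apply k _
  have hF : idealSpan k {f | EnvRel k A f} ≤ LinearMap.ker (F : _ →ₗ[k] Z) := by
    apply idealSpan_le
    · intro f hf
      change F f = 0
      cases hf with
      | zinbiel f g h => simp [hZ (F f) (F g) (F h)]
      | add a b => simp [hof]
      | smul c a => simp [hof]
      | anticomm a b => simp [hof, hφ]
    · intro a f hf
      change F (a * f) = 0 ∧ F (f * a) = 0
      have hf : F f = 0 := hf
      simp [hf]
  let L : Envelope k A →ₗ[k] Z := (idealSpan k {f | EnvRel k A f}).liftQ (F : _ →ₗ[k] Z) hF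
  have hL : ∀ f, L (AlgQuot.mk k _ f) = F f := fun f => Submodule.liftQ_apply _ _ _
  refine ⟨{ toFun := L, map_smul' := L.map_smul, map_zero' := L.map_zero, map_add' := L.map_add,
            map_mul' := ?_ }, ?_, ?_⟩
  · intro a b
    obtain ⟨a, rfl⟩ := AlgQuot.mk_surjective k a
    obtain ⟨b, rfl⟩ := AlgQuot.mk_surjective k b
    rw [← AlgQuot.mk_mul]
    simp [hL]
  · intro a
    exact (hL _).trans (hof a)
  · intro ψ hψ
    let q : FreeNonUnitalNonAssocAlgebra k A →ₙₐ[k] Envelope k A :=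
      { toFun := AlgQuot.mk k _
        map_smul' := map_smul _
        map_zero' := map_zero _
        map_add' := map_add _
        map_mul' := AlgQuot.mk_mul k }
    have hq : ψ.comp q = F := by
      apply FreeNonUnitalNonAssocAlgebra.hom_ext
      intro a
      rw [hof]
      exact hψ a
    ext a
    obtain ⟨a, rfl⟩ := AlgQuot.mk_surjective k a
    exact (DFunLike.congr_fun hq a).trans (hL a).symm

end Envelope

/-! ### Gröbner–Shirshov bases in the free nonassociative algebra `M⟨X⟩`

The nonempty nonassociative words `X**` are the elements of `FreeMagma X`, and `M⟨X⟩` is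
`FreeNonUnitalNonAssocAlgebra k X`, with linear basis `X**`. -/

section GSB

variable {X : Type*}

/-- The order on words: compare the weights `wt(x) = (1, x)` for `x ∈ X` and
`wt(u₁u₂) = (|u₁u₂|, u₂, u₁)` lexicographically. -/
def WordLT [LT X] : FreeMagma X → FreeMagma X → Prop
  | .of x, .of y => x < y
  | .of _, .mul _ _ => True
  | .mul _ _, .of _ => False
  | .mul u₁ u₂, .mul v₁ v₂ =>
      u₁.length + u₂.length < v₁.length + v₂.length ∨
      (u₁.length + u₂.length = v₁.length + v₂.length ∧
        (WordLT u₂ v₂ ∨ (u₂ = v₂ ∧ WordLT u₁ v₁)))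

/-- Words in `X ∪ {⋆}` in which the letter `⋆` occurs exactly once. -/
inductive StarWord (X : Type*) : Type _
  | star : StarWord X
  | mulRight (u : StarWord X) (v : FreeMagma X) : StarWord X
  | mulLeft (v : FreeMagma X) (u : StarWord X) : StarWord X

/-- `u|_{⋆ = w}` for a word `w`. -/
def StarWord.subst : StarWord X → FreeMagma X → FreeMagma X
  | .star, w => w
  | .mulRight u v, w => u.subst w * v
  | .mulLeft v u, w => v * u.subst w

variable (k : Type*) [Field k]

/-- A word regarded as a monomial of `M⟨X⟩`. -/
def word (u : FreeMagma X) : FreeNonUnitalNonAssocAlgebra k X := MonoidAlgebra.ofMagma k _ u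

variable {k}

/-- `u|_{⋆ = f}` for a polynomial `f ∈ M⟨X⟩`. -/
def StarWord.eval : StarWord X → FreeNonUnitalNonAssocAlgebra k X →
    FreeNonUnitalNonAssocAlgebra k X
  | .star, f => f
  | .mulRight u v, f => u.eval f * word k v
  | .mulLeft v u, f => word k v * u.eval f

variable [LT X]

/-- `f` is monic with leading monomial `w`. -/
def IsMonicWith (f : FreeNonUnitalNonAssocAlgebra k X) (w : FreeMagma X) : Prop :=
  f.coeff w = 1 ∧ ∀ v : FreeMagma X, f.coeff v ≠ 0 → v = w ∨ WordLT v w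

/-- `h` is trivial modulo `(S, w)`: it is a linear combination of polynomials `u|_{⋆ = s}` with
`s ∈ S` and `u|_{⋆ = s̄} < w`, where `s̄` is the leading monomial of the monic polynomial `s`. -/
def TrivialMod (S : Set (FreeNonUnitalNonAssocAlgebra k X)) (w : FreeMagma X)
    (h : FreeNonUnitalNonAssocAlgebra k X) : Prop :=
  h ∈ Submodule.span k {p | ∃ s ∈ S, ∃ (s' : FreeMagma X) (u : StarWord X),
    IsMonicWith s s' ∧ WordLT (u.subst s') w ∧ p = u.eval s}

/-- `S` is a Gröbner–Shirshov basis: it consists of monic polynomials, and all compositions of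
inclusion `f - u|_{⋆ = g}` (`f, g ∈ S`, `f̄ = u|_{⋆ = ḡ}`) are trivial modulo `(S, f̄)`. -/
def IsGSB (S : Set (FreeNonUnitalNonAssocAlgebra k X)) : Prop :=
  (∀ f ∈ S, ∃ f' : FreeMagma X, IsMonicWith f f') ∧
  ∀ f ∈ S, ∀ g ∈ S, ∀ (f' g' : FreeMagma X), IsMonicWith f f' → IsMonicWith g g' →
    ∀ u : StarWord X, f' = u.subst g' → TrivialMod S f' (f - u.eval g)

end GSB

/-- The set of polynomials of the claimed Gröbner–Shirshov basis. Words are nonempty, so a word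
`a` of even length has length at least `2`. -/
inductive ZeroMulRel (k : Type*) [Field k] (X : Type*) [LT X] :
    FreeNonUnitalNonAssocAlgebra k X → Prop
  | zinbiel (a b c : FreeMagma X) :
      ZeroMulRel k X (word k (a * (b * c)) - word k ((a * b) * c) - word k ((b * a) * c))
  | anticomm (x y : X) (hxy : x < y) :
      ZeroMulRel k X (word k (.of x * .of y) + word k (.of y * .of x))
  | square (x : X) : ZeroMulRel k X (word k (.of x * .of x))
  | evenAnticomm (a : FreeMagma X) (x y : X) (ha : Even a.length) (hxy : x < y) :
      ZeroMulRel k X (word k ((a * .of x) * .of y) + word k ((a * .of y) * .of x))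
  | evenSquare (a : FreeMagma X) (x : X) (ha : Even a.length) :
      ZeroMulRel k X (word k ((a * .of x) * .of x))

end PreCom

end

noncomputable section

namespace PreCom

/-! ### The order on words -/

section WordOrder

variable {X : Type*}

/-! No composition is computed. Every word not divisible by a leading monomial of `S` is a
left-normed word `x₁x₂⋯xₙ` with `x₁ > x₂`, `x₃ > x₄`, and so on (`normalWord_or_reducible`). A
composition `f - u|_{⋆=g}` has all its monomials below `f̄`, so division writes it as `t + n`, with
`t` trivial modulo `(S, f̄)` and `n` a combination of these normal words. It remains to show `n =
0`, and for this one homomorphism suffices that kills `S` and is injective on the span of the normal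
words (`isGSB_of_hom`).

Such a homomorphism goes to a concrete model. In a Zinbiel algebra with anticommuting generators,
consecutive letters of a left-normed word pair up alternatingly, and the pairs multiply by
shuffling. Even elements are therefore shuffle series in pairs of letters, odd ones carry an extra
last letter, and an odd element times an even one is zero. The coefficients at lists of decreasing
pairs are dual to the normal words, which gives injectivity
(`linearIndependent_toModel_normalWord`).

For the envelope, zero multiplication on `A` means exactly that the elements `ι a` anticommute. In
every Zinbiel algebra this forces the remaining relations of `S` (`IsZinbiel.parity`,
`IsZinbiel.even_anticomm`), the squares after division by 2. Conversely, `M⟨X⟩ / I(S)` is Zinbiel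
with anticommuting letters, so the universal property of the envelope maps back to it. -/

theorem length_mul (u v : FreeMagma X) : (u * v).length = u.length + v.length := rfl

section LT

variable [LT X]

@[simp] theorem wordLT_of_of {x y : X} : WordLT (.of x) (.of y) ↔ x < y := by
  simp [WordLT]

@[simp] theorem wordLT_of_mul {x : X} {u v : FreeMagma X} : WordLT (.of x) (u * v) := by
  change WordLT (.of x) (.mul u v)
  simp [WordLT]

@[simp] theorem not_wordLT_mul_of {x : X} {u v : FreeMagma X} : ¬ WordLT (u * v) (.of x) := by
  change ¬ WordLT (.mul u v) (.of x)
  simp [WordLT]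

theorem wordLT_mul_mul {u₁ u₂ v₁ v₂ : FreeMagma X} : WordLT (u₁ * u₂) (v₁ * v₂) ↔
    u₁.length + u₂.length < v₁.length + v₂.length ∨
      (u₁.length + u₂.length = v₁.length + v₂.length ∧
        (WordLT u₂ v₂ ∨ (u₂ = v₂ ∧ WordLT u₁ v₁))) := by
  change WordLT (.mul u₁ u₂) (.mul v₁ v₂) ↔ _
  rw [WordLT]

theorem WordLT.length_le {u v : FreeMagma X} (h : WordLT u v) : u.length ≤ v.length := by
  induction u with
  | ih1 x => exact v.length_pos
  | ih2 u₁ u₂ _ _ =>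
    induction v with
    | ih1 y => simp at h
    | ih2 v₁ v₂ _ _ =>
      rw [wordLT_mul_mul] at h
      simp only [length_mul]
      omega

theorem wordLT_of_length_lt {u v : FreeMagma X} (h : u.length < v.length) : WordLT u v := by
  cases v with
  | of y => exact absurd h (Nat.not_lt.2 u.length_pos)
  | mul v₁ v₂ =>
    cases u with
    | of x => exact wordLT_of_mul
    | mul u₁ u₂ => exact wordLT_mul_mul.2 (.inl h)

/-- Passing to a smaller factor never increases the length, and at equal total length the comparison
falls on the changed factor. -/
theorem WordLT.subst {v w : FreeMagma X} (h : WordLT v w) (u : StarWord X) :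
    WordLT (u.subst v) (u.subst w) := by
  induction u with
  | star => exact h
  | mulRight u t ih =>
    have := ih.length_le
    simp only [StarWord.subst, wordLT_mul_mul, ih, and_true, or_true]
    omega
  | mulLeft t u ih =>
    have := ih.length_le
    simp only [StarWord.subst, wordLT_mul_mul, ih, true_or, and_true]
    omega

end LT

theorem WordLT.trans [Preorder X] {u v w : FreeMagma X} (huv : WordLT u v) (hvw : WordLT v w) :
    WordLT u w := by
  induction w generalizing u v with
  | ih1 z =>
    cases v with
    | of y =>
      cases u with
      | of x => simp only [wordLT_of_of] at *; exact huv.trans hvw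
      | mul u₁ u₂ => exact absurd huv not_wordLT_mul_of
    | mul v₁ v₂ => exact absurd hvw not_wordLT_mul_of
  | ih2 w₁ w₂ ih₁ ih₂ =>
    cases u with
    | of x => exact wordLT_of_mul
    | mul u₁ u₂ =>
      cases v with
      | of y => exact absurd huv not_wordLT_mul_of
      | mul v₁ v₂ =>
        refine wordLT_mul_mul.2 ?_
        rcases wordLT_mul_mul.1 huv with h | ⟨e, h⟩
        · left; rcases wordLT_mul_mul.1 hvw with h' | h' <;> omega
        · rcases wordLT_mul_mul.1 hvw with h' | ⟨e', h'⟩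
          · left; omega
          · refine Or.inr ⟨e.trans e', ?_⟩
            rcases h with h | ⟨rfl, h⟩
            · rcases h' with h' | ⟨rfl, _⟩
              · exact .inl (ih₂ h h')
              · exact .inl h
            · rcases h' with h' | ⟨rfl, h'⟩
              · exact .inl h'
              · exact .inr ⟨rfl, ih₁ h h'⟩

/-- Strong induction on length makes both factors of a word accessible. Within a fixed length the
order is lexicographic in (right factor, left factor), so accessibility of the right factor is
unfolded first, then that of the left one. -/
theorem wellFounded_wordLT [LT X] [WellFoundedLT X] :
    WellFounded (WordLT : FreeMagma X → FreeMagma X → Prop) := by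
  have hof (x : X) : Acc WordLT (FreeMagma.of x) := by
    induction x using WellFoundedLT.induction with
    | ind x ih =>
      refine ⟨_, fun v hv => ?_⟩
      cases v with
      | of y => exact ih y (wordLT_of_of.1 hv)
      | mul v₁ v₂ => exact absurd hv not_wordLT_mul_of
  refine ⟨fun w => ?_⟩
  induction hn : w.length using Nat.strong_induction_on generalizing w with
  | _ n IH =>
  cases w with
  | of x => exact hof x
  | mul w₁ w₂ =>
    have hpos₁ := w₁.length_pos
    have hpos₂ := w₂.length_pos
    change w₁.length + w₂.length = n at hn
    have acc₂ : Acc WordLT w₂ := IH _ (by omega) _ rfl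
    induction acc₂ generalizing w₁ with
    | intro w₂ _ ih₂ =>
    have acc₁ : Acc WordLT w₁ := IH _ (by omega) _ rfl
    induction acc₁ with
    | intro w₁ _ ih₁ =>
    refine ⟨_, fun v hv => ?_⟩
    cases v with
    | of y => exact hof y
    | mul v₁ v₂ =>
      have h₁ := v₁.length_pos
      have h₂ := v₂.length_pos
      rcases wordLT_mul_mul.1 hv with h | ⟨e, h | ⟨rfl, h⟩⟩
      · exact IH (v₁.length + v₂.length) (by omega) _ rfl
      · exact ih₂ v₂ h v₁ h₁ h₂ (by omega)
      · exact ih₁ v₁ h h₁ (by omega)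

theorem not_wordLT_self [LT X] [WellFoundedLT X] (w : FreeMagma X) : ¬ WordLT w w :=
  wellFounded_wordLT.irrefl.irrefl w

end WordOrder

/-! ### Leading monomials and substitution -/

section Leading

variable {k : Type*} [Field k] {X : Type*}

theorem word_mul (u v : FreeMagma X) : word k (u * v) = word k u * word k v :=
  map_mul (MonoidAlgebra.ofMagma k (FreeMagma X)) u v

theorem coeff_word (u : FreeMagma X) : (word k u).coeff = Finsupp.single u 1 := rfl

theorem mem_span_word {s : Set (FreeMagma X)} {f : FreeNonUnitalNonAssocAlgebra k X} :
    f ∈ Submodule.span k (word k '' s) ↔ ∀ v, f.coeff v ≠ 0 → v ∈ s := by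
  constructor
  · intro hf v
    induction hf using Submodule.span_induction with
    | mem f hf =>
      obtain ⟨u, hu, rfl⟩ := hf
      rw [coeff_word]
      intro h
      by_cases e : u = v
      · exact e ▸ hu
      · simp [e] at h
    | zero => simp
    | add f g _ _ hf hg =>
      intro h
      by_contra hv
      apply h
      rw [MonoidAlgebra.coeff_add, Finsupp.add_apply, not_ne_iff.1 (mt hf hv),
        not_ne_iff.1 (mt hg hv), add_zero]
    | smul c f _ hf =>
      intro h
      refine hf fun h' => h ?_
      rw [MonoidAlgebra.coeff_smul, Finsupp.smul_apply, h', smul_zero]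
  · intro h
    rw [← MonoidAlgebra.sum_coeff_single f]
    refine Submodule.sum_mem _ fun v hv => ?_
    have : MonoidAlgebra.single v (f.coeff v) = f.coeff v • word k v := by
      ext1
      simp [coeff_word]
    rw [this]
    exact Submodule.smul_mem _ _
      (Submodule.subset_span ⟨v, h v (Finsupp.mem_support_iff.1 hv), rfl⟩)

variable (k) in
/-- The polynomials all of whose monomials are smaller than `w`. -/
def lowerTerms [LT X] (w : FreeMagma X) : Submodule k (FreeNonUnitalNonAssocAlgebra k X) :=
  Submodule.span k (word k '' {v | WordLT v w})

theorem word_mem_lowerTerms [LT X] {v w : FreeMagma X} (h : WordLT v w) :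
    word k v ∈ lowerTerms k w :=
  Submodule.subset_span ⟨v, h, rfl⟩

theorem IsMonicWith.sub_mem [LT X] {f : FreeNonUnitalNonAssocAlgebra k X} {w : FreeMagma X}
    (h : IsMonicWith f w) : f - word k w ∈ lowerTerms k w := by
  refine mem_span_word.2 fun v hv => ?_
  rw [MonoidAlgebra.coeff_sub, Finsupp.sub_apply, coeff_word] at hv
  by_cases e : v = w
  · subst e
    simp [h.1] at hv
  · rw [Finsupp.single_eq_of_ne e, sub_zero] at hv
    exact (h.2 v hv).resolve_left e

theorem isMonicWith_of_sub_mem [LT X] [WellFoundedLT X] {f : FreeNonUnitalNonAssocAlgebra k X}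
    {w : FreeMagma X} (h : f - word k w ∈ lowerTerms k w) : IsMonicWith f w := by
  have h := mem_span_word.1 h
  constructor
  · by_contra hne
    refine not_wordLT_self w (h w ?_)
    simpa [coeff_word, sub_eq_zero] using hne
  · intro v hv
    by_cases e : v = w
    · exact .inl e
    · refine .inr (h v ?_)
      simpa [coeff_word, Finsupp.single_eq_of_ne e] using hv

/-- Substitution for the letter `⋆` as a linear map. -/
def StarWord.evalₗ (u : StarWord X) :
    FreeNonUnitalNonAssocAlgebra k X →ₗ[k] FreeNonUnitalNonAssocAlgebra k X where
  toFun := u.eval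
  map_add' f g := by
    induction u with
    | star => rfl
    | mulRight u v ih => simp only [StarWord.eval, ih, add_mul]
    | mulLeft v u ih => simp only [StarWord.eval, ih, mul_add]
  map_smul' c f := by
    induction u with
    | star => rfl
    | mulRight u v ih => simp only [StarWord.eval, ih, smul_mul_assoc, RingHom.id_apply]
    | mulLeft v u ih => simp only [StarWord.eval, ih, mul_smul_comm, RingHom.id_apply]

theorem StarWord.eval_word (u : StarWord X) (v : FreeMagma X) :
    u.eval (word k v) = word k (u.subst v) := by
  induction u with
  | star => rfl
  | mulRight u t ih => simp only [StarWord.eval, StarWord.subst, ih, word_mul]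
  | mulLeft t u ih => simp only [StarWord.eval, StarWord.subst, ih, word_mul]

theorem StarWord.eval_mem_lowerTerms [LT X] (u : StarWord X)
    {f : FreeNonUnitalNonAssocAlgebra k X} {w : FreeMagma X} (h : f ∈ lowerTerms k w) :
    u.eval f ∈ lowerTerms k (u.subst w) := by
  change f ∈ (lowerTerms k (u.subst w)).comap (StarWord.evalₗ u)
  refine Submodule.span_le.2 ?_ h
  rintro _ ⟨v, hv, rfl⟩
  change u.eval (word k v) ∈ lowerTerms k (u.subst w)
  rw [StarWord.eval_word]
  exact word_mem_lowerTerms (WordLT.subst hv u)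

theorem IsMonicWith.eval_sub_mem [LT X] {f : FreeNonUnitalNonAssocAlgebra k X} {w : FreeMagma X}
    (h : IsMonicWith f w) (u : StarWord X) :
    u.eval f - word k (u.subst w) ∈ lowerTerms k (u.subst w) := by
  have := u.eval_mem_lowerTerms h.sub_mem
  rwa [show u.eval (f - word k w) = u.eval f - u.eval (word k w) from
    map_sub (StarWord.evalₗ u) f (word k w), StarWord.eval_word] at this

end Leading

/-! ### A criterion for Gröbner–Shirshov bases -/

section Criterion

variable {k : Type*} [Field k] {X : Type*}

/-- If all words are normal or divisible by a leading monomial of `S`, then a polynomial with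
monomials below `w` is a combination of normal words modulo polynomials trivial modulo `(S, w)`. -/
theorem exists_trivialMod_add_normal [Preorder X] [WellFoundedLT X]
    {S : Set (FreeNonUnitalNonAssocAlgebra k X)} {N : Set (FreeMagma X)}
    (hN : ∀ w, w ∈ N ∨ ∃ s ∈ S, ∃ (s' : FreeMagma X) (u : StarWord X),
      IsMonicWith s s' ∧ w = u.subst s')
    (w : FreeMagma X) {h : FreeNonUnitalNonAssocAlgebra k X} (hh : h ∈ lowerTerms k w) :
    ∃ t n, TrivialMod S w t ∧ n ∈ Submodule.span k (word k '' N) ∧ t + n = h := by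
  let T : Submodule k (FreeNonUnitalNonAssocAlgebra k X) :=
    Submodule.span k {p | ∃ s ∈ S, ∃ (s' : FreeMagma X) (u : StarWord X),
      IsMonicWith s s' ∧ WordLT (u.subst s') w ∧ p = u.eval s}
  suffices key : ∀ v, WordLT v w → word k v ∈ T ⊔ Submodule.span k (word k '' N) by
    have : lowerTerms k w ≤ T ⊔ Submodule.span k (word k '' N) := by
      refine Submodule.span_le.2 ?_
      rintro _ ⟨v, hv, rfl⟩
      exact key v hv
    obtain ⟨t, ht, n, hn, e⟩ := Submodule.mem_sup.1 (this hh)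
    exact ⟨t, n, ht, hn, e⟩
  intro v
  induction v using (wellFounded_wordLT (X := X)).induction with
  | _ v ih =>
  intro hv
  rcases hN v with hv' | ⟨s, hs, s', u, hs', rfl⟩
  · exact Submodule.mem_sup_right (Submodule.subset_span ⟨v, hv', rfl⟩)
  -- One division step: subtracting `u|_{⋆=s}` replaces the word by strictly smaller ones, to which
  -- the induction applies.
  · have h₁ : u.eval s ∈ T := Submodule.subset_span ⟨s, hs, s', u, hs', hv, rfl⟩
    have h₂ : u.eval s - word k (u.subst s') ∈ T ⊔ Submodule.span k (word k '' N) := by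
      refine (Submodule.span_le.2 ?_ : lowerTerms k (u.subst s') ≤ _) (hs'.eval_sub_mem u)
      rintro _ ⟨v', hv', rfl⟩
      exact ih v' hv' (WordLT.trans hv' hv)
    simpa using sub_mem (Submodule.mem_sup_left h₁) h₂

/-- If a homomorphism annihilates a set `S` of monic polynomials and is injective on the span of the
words that are not divisible by leading monomials of `S`, then `S` is a Gröbner–Shirshov basis. -/
theorem isGSB_of_hom [Preorder X] [WellFoundedLT X]
    {S : Set (FreeNonUnitalNonAssocAlgebra k X)} {N : Set (FreeMagma X)}
    (hN : ∀ w, w ∈ N ∨ ∃ s ∈ S, ∃ (s' : FreeMagma X) (u : StarWord X),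
      IsMonicWith s s' ∧ w = u.subst s')
    (hS : ∀ f ∈ S, ∃ f' : FreeMagma X, IsMonicWith f f')
    {Z : Type*} [NonUnitalNonAssocSemiring Z] [Module k Z]
    (φ : FreeNonUnitalNonAssocAlgebra k X →ₙₐ[k] Z) (hφ : ∀ f ∈ S, φ f = 0)
    (hinj : ∀ n ∈ Submodule.span k (word k '' N), φ n = 0 → n = 0) : IsGSB S := by
  have heval (u : StarWord X) (g : FreeNonUnitalNonAssocAlgebra k X) (hg : φ g = 0) :
      φ (u.eval g) = 0 := by
    induction u with
    | star => exact hg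
    | mulRight u v ih => rw [StarWord.eval, map_mul, ih, zero_mul]
    | mulLeft v u ih => rw [StarWord.eval, map_mul, ih, mul_zero]
  refine ⟨hS, ?_⟩
  rintro f hf g hg f' g' hf' hg' u rfl
  -- Both polynomials are monic with the same leading monomial, which cancels.
  have hlow : f - u.eval g ∈ lowerTerms k (u.subst g') := by
    simpa using sub_mem hf'.sub_mem (hg'.eval_sub_mem u)
  obtain ⟨t, n, ht, hn, e⟩ := exists_trivialMod_add_normal hN _ hlow
  have hφt : φ t = 0 := by
    refine (?_ : _ ≤ LinearMap.ker (φ : FreeNonUnitalNonAssocAlgebra k X →ₗ[k] Z)) ht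
    refine Submodule.span_le.2 ?_
    rintro _ ⟨s, hs, s', u, -, -, rfl⟩
    exact heval u s (hφ s hs)
  have hφn : φ n = 0 := by
    have hfg : f = u.eval g + (t + n) := by rw [e]; abel
    have := hφ f hf
    rwa [hfg, map_add, map_add, hφt, heval u g (hφ g hg), zero_add, zero_add] at this
  rw [hinj n hn hφn, add_zero] at e
  exact e ▸ ht

end Criterion

/-! ### The shuffle algebra -/

/-- Formal series in noncommuting variables `P`, with the shuffle product. -/
def ShuffleSeries (k P : Type*) : Type _ := List P → k

namespace ShuffleSeries

@[ext] theorem ext {k P : Type*} {f g : ShuffleSeries k P} (h : ∀ l : List P, f l = g l) :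
    f = g :=
  funext h

variable {k P : Type*} [CommRing k]

instance : AddCommGroup (ShuffleSeries k P) := inferInstanceAs (AddCommGroup (List P → k))

instance : Module k (ShuffleSeries k P) := inferInstanceAs (Module k (List P → k))

/-- The constant term. -/
def const : ShuffleSeries k P →ₗ[k] k := LinearMap.proj (φ := fun _ : List P => k) []

/-- The derivation that strips off the first letter `p`. -/
def deriv (p : P) : ShuffleSeries k P →ₗ[k] ShuffleSeries k P :=
  LinearMap.funLeft k k (fun l : List P => p :: l)

/-- The series with constant term `c` and derivatives `F p`. -/
def ofDeriv (c : k) (F : P → ShuffleSeries k P) : ShuffleSeries k P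
  | [] => c
  | p :: l => F p l

@[simp] theorem const_ofDeriv (c : k) (F : P → ShuffleSeries k P) : const (ofDeriv c F) = c := rfl

@[simp] theorem deriv_ofDeriv (c : k) (F : P → ShuffleSeries k P) (p : P) :
    deriv p (ofDeriv c F) = F p := rfl

theorem ext_deriv {f g : ShuffleSeries k P} (h₀ : const f = const g)
    (h : ∀ p, deriv p f = deriv p g) : f = g := by
  ext l
  cases l with
  | nil => exact h₀
  | cons p l => exact congrFun (h p) l

/-- The coefficients of the shuffle product. -/
def shuffle : List P → ShuffleSeries k P → ShuffleSeries k P → k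
  | [], f, g => const f * const g
  | p :: l, f, g => shuffle l (deriv p f) g + shuffle l f (deriv p g)

instance : Mul (ShuffleSeries k P) := ⟨fun f g l => shuffle l f g⟩

instance : One (ShuffleSeries k P) := ⟨ofDeriv 1 fun _ => 0⟩

@[simp] theorem const_mul (f g : ShuffleSeries k P) : const (f * g) = const f * const g := rfl

@[simp] theorem deriv_mul (p : P) (f g : ShuffleSeries k P) :
    deriv p (f * g) = deriv p f * g + f * deriv p g := rfl

@[simp] theorem deriv_one (p : P) : deriv p (1 : ShuffleSeries k P) = 0 := rfl

theorem mul_cons (f g : ShuffleSeries k P) (p : P) (l : List P) :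
    (f * g) (p :: l) = (deriv p f * g) l + (f * deriv p g) l := rfl

theorem add_coe (f g : ShuffleSeries k P) (l : List P) : (f + g) l = f l + g l := rfl

/-- Each `deriv p` obeys the Leibniz rule by definition of the product. This and the following ring
axioms are therefore checked coefficient by coefficient, by induction on the list with the series
left arbitrary. -/
protected theorem mul_comm (f g : ShuffleSeries k P) : f * g = g * f := by
  ext l
  induction l generalizing f g with
  | nil => exact _root_.mul_comm _ _
  | cons p l ih => rw [mul_cons, mul_cons, ih, ih f, add_comm]

protected theorem mul_add (f g h : ShuffleSeries k P) : f * (g + h) = f * g + f * h := by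
  ext l
  induction l generalizing f g h with
  | nil => exact _root_.mul_add _ _ _
  | cons p l ih => simp only [add_coe, mul_cons, map_add, ih]; ring

protected theorem smul_mul (c : k) (f g : ShuffleSeries k P) : c • f * g = c • (f * g) := by
  ext l
  induction l generalizing f g with
  | nil => exact _root_.mul_assoc _ _ _
  | cons p l ih =>
    have hs (f : ShuffleSeries k P) (l) : (c • f) l = c * f l := rfl
    simp only [hs, mul_cons, map_smul, ih] at ih ⊢
    ring

protected theorem add_mul (f g h : ShuffleSeries k P) : (f + g) * h = f * h + g * h := by
  rw [ShuffleSeries.mul_comm, ShuffleSeries.mul_add, ShuffleSeries.mul_comm h,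
    ShuffleSeries.mul_comm h]

protected theorem zero_mul (f : ShuffleSeries k P) : 0 * f = 0 := by
  have := ShuffleSeries.smul_mul 0 (0 : ShuffleSeries k P) f
  simpa using this

protected theorem one_mul (f : ShuffleSeries k P) : 1 * f = f := by
  ext l
  induction l generalizing f with
  | nil => exact _root_.one_mul _
  | cons p l ih =>
    rw [mul_cons, deriv_one, ShuffleSeries.zero_mul, ih]
    exact _root_.zero_add _

protected theorem mul_assoc (f g h : ShuffleSeries k P) : f * g * h = f * (g * h) := by
  ext l
  induction l generalizing f g h with
  | nil => exact _root_.mul_assoc _ _ _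
  | cons p l ih =>
    simp only [mul_cons, deriv_mul, ShuffleSeries.add_mul, ShuffleSeries.mul_add, add_coe, ih]
    ring

instance : CommRing (ShuffleSeries k P) where
  __ := (inferInstance : AddCommGroup (ShuffleSeries k P))
  mul_comm := ShuffleSeries.mul_comm
  left_distrib := ShuffleSeries.mul_add
  right_distrib := ShuffleSeries.add_mul
  zero_mul := ShuffleSeries.zero_mul
  mul_zero f := by rw [ShuffleSeries.mul_comm, ShuffleSeries.zero_mul]
  one_mul := ShuffleSeries.one_mul
  mul_one f := by rw [ShuffleSeries.mul_comm, ShuffleSeries.one_mul]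
  mul_assoc := ShuffleSeries.mul_assoc

instance : Algebra k (ShuffleSeries k P) :=
  Algebra.ofModule ShuffleSeries.smul_mul fun c f g => by
    rw [mul_comm, ShuffleSeries.smul_mul, mul_comm]

end ShuffleSeries

/-! ### The model -/

/-- Pairs consisting of an even part, a shuffle series in the pairs of letters, and an odd part,
a family of such series indexed by the last, unpaired letter. -/
def Model (k X : Type*) : Type _ := ShuffleSeries k (X × X) × (X → ShuffleSeries k (X × X))

namespace Model

open ShuffleSeries

variable {k X : Type*} [CommRing k]

instance : AddCommGroup (Model k X) :=
  inferInstanceAs (AddCommGroup (ShuffleSeries k (X × X) × (X → ShuffleSeries k (X × X))))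

instance : Module k (Model k X) :=
  inferInstanceAs (Module k (ShuffleSeries k (X × X) × (X → ShuffleSeries k (X × X))))

/-- The even part. -/
def even : Model k X →ₗ[k] ShuffleSeries k (X × X) := LinearMap.fst k _ _

/-- The component of the odd part at the last letter `x`. -/
def odd (x : X) : Model k X →ₗ[k] ShuffleSeries k (X × X) :=
  LinearMap.proj x ∘ₗ LinearMap.snd k _ (X → ShuffleSeries k (X × X))

/-- The element with given even and odd parts. -/
def mk (f : ShuffleSeries k (X × X)) (g : X → ShuffleSeries k (X × X)) : Model k X := (f, g)

@[simp] theorem odd_mk (f : ShuffleSeries k (X × X)) (g : X → ShuffleSeries k (X × X)) (x : X) :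
    odd x (mk f g) = g x := rfl

theorem ext {u v : Model k X} (h₀ : const (even u) = const (even v))
    (h₁ : ∀ p q, deriv (p, q) (even u) = deriv (p, q) (even v)) (h₂ : ∀ x, odd x u = odd x v) :
    u = v :=
  Prod.ext (ext_deriv h₀ fun p => h₁ p.1 p.2) (funext h₂)

/-- The product `u (v y) = (u ⧢ v) y`, where shuffles of odd elements vanish. -/
instance : Mul (Model k X) where
  mul u v := mk
    -- The head of a list stands for the last pair of a word. For even `u` and `v = v'pq` the
    -- product is `(u ⧢ v')pq`. For `u = u'p` and `v = v'q` it is `(u' ⧢ v')pq`, antisymmetrized in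
    -- `p` and `q`.
    (ofDeriv 0 fun p => even u * deriv p (even v) + odd p.1 u * odd p.2 v - odd p.2 u * odd p.1 v)
    fun x => even u * odd x v

@[simp] theorem const_even_mul (u v : Model k X) : const (even (u * v)) = 0 := rfl

@[simp] theorem deriv_even_mul (u v : Model k X) (p q : X) :
    deriv (p, q) (even (u * v)) =
      even u * deriv (p, q) (even v) + odd p u * odd q v - odd q u * odd p v := rfl

@[simp] theorem odd_mul (u v : Model k X) (x : X) : odd x (u * v) = even u * odd x v := rfl

instance : NonUnitalNonAssocRing (Model k X) where
  left_distrib u v w := by apply ext <;> intros <;> simp <;> ring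
  right_distrib u v w := by apply ext <;> intros <;> simp <;> ring
  zero_mul u := by apply ext <;> intros <;> simp
  mul_zero u := by apply ext <;> intros <;> simp

instance : IsScalarTower k (Model k X) (Model k X) where
  smul_assoc c u v := by apply ext <;> intros <;> simp [smul_add, smul_sub]

instance : SMulCommClass k (Model k X) (Model k X) where
  smul_comm c u v := by apply ext <;> intros <;> simp [smul_add, smul_sub]

/-- Symmetrizing cancels the odd contributions and, by Leibniz, leaves the shuffle product of the
even parts, except that products in the model have no constant term. The hypothesis removes this
discrepancy; it holds for images of words. -/
theorem mul_mul {u v : Model k X} (h : const (even u) * const (even v) = 0) (w : Model k X) :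
    u * (v * w) = (u * v) * w + (v * u) * w := by
  have key : even (u * v) + even (v * u) = even u * even v := by
    refine ext_deriv (by simp [h]) fun ⟨p, q⟩ => ?_
    simp only [map_add, deriv_even_mul, ShuffleSeries.deriv_mul]
    ring
  rw [← add_mul]
  apply ext
  · simp
  · intro p q
    simp only [deriv_even_mul, odd_mul, map_add, key]
    ring
  · intro x
    simp only [odd_mul, map_add, key, mul_assoc]

/-! ### Letters of the model and their alternating relations -/

open Classical in
/-- The letter `x`. -/
def letter (x : X) : Model k X := mk 0 fun y => if y = x then 1 else 0

@[simp] theorem even_letter (x : X) : even (letter x : Model k X) = 0 := rfl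

open Classical in
theorem odd_letter (x y : X) : odd y (letter x : Model k X) = if y = x then 1 else 0 := by
  simp only [letter, odd_mk]

theorem letter_mul_letter (x y : X) :
    (letter x * letter y + letter y * letter x : Model k X) = 0 := by
  apply ext <;> intros <;> simp
  ring

/-- The pairing of odd parts is alternating, not merely antisymmetric, so squares vanish in
characteristic 2 as well. -/
theorem letter_mul_self (x : X) : (letter x * letter x : Model k X) = 0 := by
  apply ext <;> intros <;> simp
  ring

theorem even_mul_letter {u : Model k X} (hu : ∀ x, odd x u = 0) (x : X) :
    even (u * letter x) = 0 :=
  ext_deriv rfl fun ⟨p, q⟩ => by simp [hu]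

/-- For even `u` the product `ux` is odd with its only component at `x`, so `(ux)y` alternates in
`x` and `y`. -/
theorem mul_letter_mul_letter {u : Model k X} (hu : ∀ x, odd x u = 0) (x y : X) :
    u * letter x * letter y + u * letter y * letter x = 0 := by
  apply ext <;> intros <;> simp [even_mul_letter hu]
  ring

theorem mul_letter_mul_self {u : Model k X} (hu : ∀ x, odd x u = 0) (x : X) :
    u * letter x * letter x = 0 := by
  apply ext <;> intros <;> simp [even_mul_letter hu]
  ring

end Model

/-! ### Normal words -/

section Normal

variable (k : Type*) [Field k] {X : Type*}

open ShuffleSeries Model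

variable (X) in
/-- The homomorphism from `M⟨X⟩` to the model that fixes the letters. -/
def toModel : FreeNonUnitalNonAssocAlgebra k X →ₙₐ[k] Model k X :=
  FreeNonUnitalNonAssocAlgebra.lift k letter

@[simp] theorem toModel_of (x : X) : toModel k X (word k (.of x)) = letter x :=
  FreeNonUnitalNonAssocAlgebra.lift_of_apply k _ x

theorem toModel_word_mul (u v : FreeMagma X) :
    toModel k X (word k (u * v)) = toModel k X (word k u) * toModel k X (word k v) := by
  rw [word_mul, map_mul]

theorem const_even_toModel_word (u : FreeMagma X) : const (even (toModel k X (word k u))) = 0 := by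
  cases u with
  | of x => exact congrArg (fun u => const (even u)) (toModel_of k x)
  | mul u v => exact congrArg (fun u => const (even u)) (toModel_word_mul k u v)

/-- The product of the model respects the grading by parity. This turns the even length required in
`S` into the vanishing of odd parts required by the relations of the model. -/
theorem toModel_parity (u : FreeMagma X) :
    (Even u.length → ∀ x, odd x (toModel k X (word k u)) = 0) ∧
      (Odd u.length → even (toModel k X (word k u)) = 0) := by
  induction u with
  | ih1 x =>
    refine ⟨fun h => absurd h (by simp), fun _ => ?_⟩
    rw [toModel_of, even_letter]
  | ih2 u v ihu ihv =>
    rw [toModel_word_mul, length_mul, Nat.even_add, Nat.odd_add]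
    constructor
    · intro h x
      rw [odd_mul]
      rcases Nat.even_or_odd u.length with hu | hu
      · rw [ihv.1 (h.1 hu), mul_zero]
      · rw [ihu.2 hu, zero_mul]
    · intro h
      refine ext_deriv rfl fun ⟨p, q⟩ => ?_
      rw [deriv_even_mul]
      rcases Nat.even_or_odd u.length with hu | hu
      · have hv : Odd v.length := by
          rw [← Nat.not_even_iff_odd] at h ⊢
          tauto
        simp [ihu.1 hu, ihv.2 hv]
      · simp [ihu.2 hu, ihv.1 (h.1 hu)]

theorem toModel_eq_zero {f : FreeNonUnitalNonAssocAlgebra k X} [LT X] (hf : ZeroMulRel k X f) :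
    toModel k X f = 0 := by
  cases hf with
  | zinbiel a b c =>
    simp only [map_sub, toModel_word_mul]
    rw [mul_mul (by rw [const_even_toModel_word, zero_mul]), sub_sub, sub_self]
  | anticomm x y =>
    simp only [map_add, toModel_word_mul, toModel_of, letter_mul_letter]
  | square x => rw [toModel_word_mul, toModel_of, letter_mul_self]
  | evenAnticomm a x y ha =>
    simp only [map_add, toModel_word_mul, toModel_of,
      mul_letter_mul_letter ((toModel_parity k a).1 ha)]
  | evenSquare a x ha =>
    simp only [toModel_word_mul, toModel_of, mul_letter_mul_self ((toModel_parity k a).1 ha)]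

variable (X) in
/-- Pairs of letters in decreasing order. -/
abbrev DescPair [LT X] : Type _ := {p : X × X // p.2 < p.1}

/-- The left-normed word consisting of decreasing pairs of letters followed by the letter `x`; the
pairs are listed from right to left. -/
def oddWord [LT X] : List (DescPair X) → X → FreeMagma X
  | [], x => .of x
  | d :: l, x => oddWord l d.1.1 * .of d.1.2 * .of x

/-- The left-normed words in which the letters of every complete pair decrease. -/
def normalWord [LT X] : List (DescPair X) × X ⊕ List (DescPair X) × DescPair X → FreeMagma X
  | .inl (l, x) => oddWord l x
  | .inr (l, d) => oddWord l d.1.1 * .of d.1.2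

theorem odd_length_oddWord [LT X] (l : List (DescPair X)) (x : X) :
    Odd (oddWord l x).length := by
  induction l generalizing x with
  | nil => exact odd_one
  | cons d l ih => exact (ih d.1.1).add_one.add_one

theorem even_length_oddWord_mul [LT X] (l : List (DescPair X)) (x y : X) :
    Even (oddWord l x * .of y).length :=
  (odd_length_oddWord l x).add_one

-- The hypothesis is the duality for the odd prefix. Stated this way, the lemma serves both inside
-- the induction for odd words and afterwards for even normal words.
open Classical in
theorem even_toModel_normalWord [Preorder X] {l : List (DescPair X)} {d : DescPair X}
    (h : ∀ (l' : List (DescPair X)) (y : X),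
      odd y (toModel k X (word k (oddWord l d.1.1))) (l'.map Subtype.val) =
        if y = d.1.1 ∧ l' = l then 1 else 0) (d' : DescPair X) (l' : List (DescPair X)) :
    even (toModel k X (word k (oddWord l d.1.1 * .of d.1.2))) ((d' :: l').map Subtype.val) =
      if d' = d ∧ l' = l then 1 else 0 := by
  obtain ⟨⟨p, q⟩, hd⟩ := d
  obtain ⟨⟨p', q'⟩, hd'⟩ := d'
  dsimp only at h hd hd' ⊢
  let u : Model k X := toModel k X (word k (oddWord l p))
  have hu : ∀ (l' : List (DescPair X)) (y : X), odd y u (l'.map Subtype.val) =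
    if y = p ∧ l' = l then 1 else 0 := h
  rw [toModel_word_mul]
  change deriv (p', q') (even (u * _)) (l'.map Subtype.val) = _
  rw [deriv_even_mul, toModel_of, even_letter, map_zero, mul_zero, zero_add, odd_letter,
    odd_letter]
  -- The antisymmetric partner is seen only at the reversed pair `(p', q') = (q, p)`, which is not
  -- decreasing.
  have hswap : (odd q' u * if p' = q then 1 else 0) (l'.map Subtype.val) = 0 := by
    by_cases e : p' = q
    · rw [if_pos e, mul_one, hu, if_neg]
      rintro ⟨rfl, -⟩
      exact lt_asymm hd (e ▸ hd')
    · rw [if_neg e, mul_zero]; rfl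
  change (odd p' u * if q' = q then 1 else 0) (l'.map Subtype.val) -
    (odd q' u * if p' = q then 1 else 0) (l'.map Subtype.val) = _
  rw [hswap, sub_zero]
  by_cases e : q' = q
  · rw [if_pos e, mul_one, hu]
    simp [e]
  · rw [if_neg e, mul_zero, if_neg (by simp [e])]; rfl

open Classical in
theorem odd_toModel_oddWord [Preorder X] (l l' : List (DescPair X)) (x y : X) :
    odd y (toModel k X (word k (oddWord l x))) (l'.map Subtype.val) =
      if y = x ∧ l' = l then 1 else 0 := by
  induction l generalizing l' x y with
  | nil =>
    rw [oddWord, toModel_of, odd_letter]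
    by_cases h : y = x
    · cases l' with
      | nil => simp only [h, and_self, if_true]; rfl
      | cons d l' => simp [h]; rfl
    · simp [h]; rfl
  | cons d l ih =>
    rw [oddWord, toModel_word_mul, odd_mul, toModel_of, odd_letter]
    by_cases h : y = x
    · rw [if_pos h, mul_one]
      cases l' with
      -- The coefficient at the empty list is the constant term of a product, hence zero.
      | nil => rw [if_neg (by simp), toModel_word_mul]; rfl
      | cons d' l' =>
        rw [even_toModel_normalWord k fun l' y => ih l' d.1.1 y]
        simp [h]
    · rw [if_neg h, mul_zero, if_neg fun h' => h h'.1]; rfl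

variable (X) in
/-- The coordinates of elements of the model that correspond to normal words. -/
def normalCoord [LT X] : Model k X →ₗ[k]
    (List (DescPair X) × X ⊕ List (DescPair X) × DescPair X → k) where
  toFun u
    | .inl (l, x) => odd x u (l.map Subtype.val)
    | .inr (l, d) => even u ((d :: l).map Subtype.val)
  map_add' u v := by
    funext b
    rcases b with ⟨l, x⟩ | ⟨l, d⟩ <;> rfl
  map_smul' c u := by
    funext b
    rcases b with ⟨l, x⟩ | ⟨l, d⟩ <;> rfl

open Classical in
theorem normalCoord_toModel_normalWord [Preorder X]
    (b : List (DescPair X) × X ⊕ List (DescPair X) × DescPair X) :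
    normalCoord k X (toModel k X (word k (normalWord b))) = Pi.single b 1 := by
  funext b'
  rw [Pi.single_apply]
  rcases b with ⟨l, x⟩ | ⟨l, d⟩ <;> rcases b' with ⟨l', x'⟩ | ⟨l', d'⟩
  · refine (odd_toModel_oddWord k l l' x x').trans ?_
    simp [and_comm]
  · change even (toModel k X (word k (oddWord l x))) _ = _
    rw [(toModel_parity k _).2 (odd_length_oddWord l x), if_neg (by simp)]
    rfl
  · change odd x' (toModel k X (word k (oddWord l d.1.1 * .of d.1.2))) _ = _
    rw [(toModel_parity k _).1 (even_length_oddWord_mul l _ _), if_neg (by simp)]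
    rfl
  · refine (even_toModel_normalWord k
      (fun l' y => odd_toModel_oddWord k l l' d.1.1 y) d' l').trans ?_
    simp [and_comm]

theorem linearIndependent_toModel_normalWord [Preorder X] :
    LinearIndependent k fun b : List (DescPair X) × X ⊕ List (DescPair X) × DescPair X =>
      toModel k X (word k (normalWord b)) := by
  classical
  refine LinearIndependent.of_comp (normalCoord k X) ?_
  have : normalCoord k X ∘ (fun b => toModel k X (word k (normalWord b))) =
      fun b => Pi.single b 1 := funext (normalCoord_toModel_normalWord k)
  rw [this]
  exact Pi.linearIndependent_single_one _ k

theorem eq_zero_of_toModel_eq_zero [Preorder X] {n : FreeNonUnitalNonAssocAlgebra k X}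
    (hn : n ∈ Submodule.span k (word k '' Set.range (normalWord (X := X))))
    (h : toModel k X n = 0) : n = 0 := by
  rw [← Set.range_comp, Finsupp.mem_span_range_iff_exists_finsupp] at hn
  obtain ⟨c, rfl⟩ := hn
  have hc : c = 0 := by
    refine linearIndependent_iff.1 (linearIndependent_toModel_normalWord k (X := X)) c ?_
    rw [Finsupp.linearCombination_apply, ← h, Finsupp.sum, Finsupp.sum, map_sum]
    simp only [map_smul, Function.comp_apply]
  rw [hc, Finsupp.sum_zero_index]

/-! ### Leading monomials of the relations and reducibility of words -/

variable {k}

/-- The three words have equal length and right factors are compared first, so `c`, being shorter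
than `bc`, decides. -/
theorem ZeroMulRel.zinbiel_isMonicWith [LT X] [WellFoundedLT X] (a b c : FreeMagma X) :
    IsMonicWith (word k (a * (b * c)) - word k ((a * b) * c) - word k ((b * a) * c))
      (a * (b * c)) := by
  have hc : WordLT c (b * c) := wordLT_of_length_lt (Nat.lt_add_of_pos_left b.length_pos)
  refine isMonicWith_of_sub_mem ?_
  have h₁ : WordLT (a * b * c) (a * (b * c)) := by
    simp only [wordLT_mul_mul, length_mul, hc, true_or, and_true]; omega
  have h₂ : WordLT (b * a * c) (a * (b * c)) := by
    simp only [wordLT_mul_mul, length_mul, hc, true_or, and_true]; omega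
  have := add_mem (word_mem_lowerTerms (k := k) h₁) (word_mem_lowerTerms h₂)
  convert neg_mem this using 1
  abel

/-- Covers both anticommutation relations: `u, v` are the letters `x, y`, or `ax, ay`. -/
theorem ZeroMulRel.isMonicWith_mul_add_mul [LT X] [WellFoundedLT X] (u v : FreeMagma X) {x y : X}
    (huv : u.length = v.length) (hxy : x < y) :
    IsMonicWith (word k (u * .of y) + word k (v * .of x)) (u * .of y) := by
  refine isMonicWith_of_sub_mem ?_
  rw [add_sub_cancel_left]
  exact word_mem_lowerTerms (wordLT_mul_mul.2 (.inr ⟨by rw [huv]; rfl, .inl (wordLT_of_of.2 hxy)⟩))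

theorem isMonicWith_word [LT X] [WellFoundedLT X] (u : FreeMagma X) :
    IsMonicWith (word k u) u :=
  isMonicWith_of_sub_mem (by rw [sub_self]; exact zero_mem _)

theorem ZeroMulRel.exists_isMonicWith [LT X] [WellFoundedLT X]
    {f : FreeNonUnitalNonAssocAlgebra k X} (hf : ZeroMulRel k X f) : ∃ w, IsMonicWith f w := by
  cases hf with
  | zinbiel a b c => exact ⟨_, zinbiel_isMonicWith a b c⟩
  | anticomm x y hxy => exact ⟨_, isMonicWith_mul_add_mul _ _ rfl hxy⟩
  | square x => exact ⟨_, isMonicWith_word _⟩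
  | evenAnticomm a x y ha hxy => exact ⟨_, isMonicWith_mul_add_mul _ _ rfl hxy⟩
  | evenSquare a x ha => exact ⟨_, isMonicWith_word _⟩

-- A composite right factor is reducible by the Zinbiel relation. A letter appended to an even
-- normal word keeps it normal; appended to an odd one it completes a pair, which is either
-- decreasing or the end of a leading monomial.
variable (k) in
theorem normalWord_or_reducible [LinearOrder X] [WellFoundedLT X] (w : FreeMagma X) :
    w ∈ Set.range (normalWord (X := X)) ∨
      ∃ s ∈ {f | ZeroMulRel k X f}, ∃ (s' : FreeMagma X) (u : StarWord X),
        IsMonicWith s s' ∧ w = u.subst s' := by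
  induction w with
  | ih1 x => exact .inl ⟨.inl ([], x), rfl⟩
  | ih2 w₁ w₂ ih _ =>
    cases w₂ with
    | mul b c =>
      exact .inr ⟨_, .zinbiel w₁ b c, _, .star, ZeroMulRel.zinbiel_isMonicWith w₁ b c, rfl⟩
    | of y =>
      rcases ih with ⟨⟨l, x⟩ | ⟨l, d⟩, rfl⟩ | ⟨s, hs, s', u, hs', rfl⟩
      · rcases lt_trichotomy x y with h | rfl | h
        · right
          cases l with
          | nil =>
            exact ⟨_, .anticomm x y h, _, .star, ZeroMulRel.isMonicWith_mul_add_mul _ _ rfl h, rfl⟩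
          | cons d l =>
            exact ⟨_, .evenAnticomm (oddWord l d.1.1 * .of d.1.2) x y
              (even_length_oddWord_mul l _ _) h, _, .star,
              ZeroMulRel.isMonicWith_mul_add_mul _ _ rfl h, rfl⟩
        · right
          cases l with
          | nil => exact ⟨_, .square x, _, .star, isMonicWith_word _, rfl⟩
          | cons d l =>
            exact ⟨_, .evenSquare (oddWord l d.1.1 * .of d.1.2) x
              (even_length_oddWord_mul l _ _), _, .star, isMonicWith_word _, rfl⟩
        · exact .inl ⟨.inr (l, ⟨(x, y), h⟩), rfl⟩
      · exact .inl ⟨.inl (d :: l, y), rfl⟩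
      · exact .inr ⟨s, hs, s', .mulRight u (.of y), hs', rfl⟩

variable (k X) in
theorem isGSB_zeroMulRel [LinearOrder X] [WellFoundedLT X] : IsGSB {f | ZeroMulRel k X f} :=
  isGSB_of_hom (normalWord_or_reducible k) (fun _ => ZeroMulRel.exists_isMonicWith) (toModel k X)
    (fun _ => toModel_eq_zero k) fun _ => eq_zero_of_toModel_eq_zero k

end Normal

/-! ### Zinbiel algebras with anticommuting generators -/

section Zinbiel

variable {X Z : Type*} [NonUnitalNonAssocRing Z]

/-- Anticommutation of the letters spreads to all words through the Zinbiel identity: odd times even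
is zero and odd words anticommute. The two claims feed each other, so they are proved together by
induction on total length. -/
theorem IsZinbiel.parity (hZ : IsZinbiel Z) (F : FreeMagma X →ₙ* Z)
    (hF : ∀ x y, F (.of x) * F (.of y) + F (.of y) * F (.of x) = 0) (u v : FreeMagma X)
    (hu : Odd u.length) :
    (Even v.length → F u * F v = 0) ∧ (Odd v.length → F u * F v + F v * F u = 0) := by
  induction hn : u.length + v.length using Nat.strong_induction_on generalizing u v with
  | _ n IH =>
  have hodd (u v₁ v₂ : FreeMagma X) (hu : Odd u.length) (hn : u.length + (v₁ * v₂).length = n)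
      (hv : Odd (v₁ * v₂).length) : F u * F (v₁ * v₂) + F (v₁ * v₂) * F u = 0 := by
    have h₀ := u.length_pos
    have h₁ := v₁.length_pos
    have h₂ := v₂.length_pos
    rw [length_mul] at hn hv
    rw [map_mul]
    rcases Nat.even_or_odd v₁.length with hv₁ | hv₁
    · have hv₂ : Odd v₂.length := by
        rw [Nat.odd_add] at hv
        exact Nat.not_even_iff_odd.1 fun h => Nat.not_even_iff_odd.2 (hv.2 h) hv₁
      have e₁ := (IH _ (by omega) u v₁ hu rfl).1 hv₁
      have e₂ := (IH _ (by omega) v₂ v₁ hv₂ rfl).1 hv₁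
      have e₃ := (IH _ (by omega) u v₂ hu rfl).2 hv₂
      -- Since `uv₁ = v₂v₁ = 0`, expanding gives `(v₁u)v₂ + (v₁v₂)u = 0`, and `(v₁u)v₂ = u(v₁v₂)`.
      have e₄ : F v₁ * (F u * F v₂ + F v₂ * F u) = 0 := by rw [e₃, mul_zero]
      rw [mul_add, hZ, hZ, e₁, e₂] at e₄
      rw [hZ, e₁]
      simpa using e₄
    · have hv₂ : Even v₂.length := (Nat.odd_add.1 hv).1 hv₁
      have e := (IH _ (by omega) v₁ v₂ hv₁ rfl).1 hv₂
      rw [e, zero_mul, mul_zero, add_zero]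
  -- For even `v₁, v₂` the products `(uv₁)v₂` and `(v₁u)v₂` have the same total length as before, so
  -- an inner induction on the right word is needed.
  induction v generalizing u with
  | ih1 y =>
    refine ⟨fun h => absurd h (by simp), fun hv => ?_⟩
    cases u with
    | of x => exact hF x y
    | mul u₁ u₂ =>
      rw [add_comm]
      exact hodd (.of y) u₁ u₂ hv (by rw [← hn, add_comm]; rfl) hu
  | ih2 v₁ v₂ ih₁ ih₂ =>
    refine ⟨fun hv => ?_, hodd u v₁ v₂ hu hn⟩
    have h₀ := u.length_pos
    have h₁ := v₁.length_pos
    have h₂ := v₂.length_pos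
    rw [length_mul] at hn hv
    rw [map_mul, hZ]
    rcases Nat.even_or_odd v₁.length with hv₁ | hv₁
    · have hv₂ : Even v₂.length := (Nat.even_add.1 hv).1 hv₁
      have e₁ := (ih₂ (u * v₁) (hu.add_even hv₁) (by rw [← hn, length_mul]; ring)).1 hv₂
      have e₂ := (ih₂ (v₁ * u) (hv₁.add_odd hu) (by rw [← hn, length_mul]; ring)).1 hv₂
      rw [map_mul] at e₁ e₂
      rw [e₁, e₂, add_zero]
    · rw [← add_mul, (IH _ (by omega) u v₁ hu rfl).2 hv₁, zero_mul]

/-- Expand `a(xy + yx) = 0` and drop the terms containing `xa = ya = 0`. -/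
theorem IsZinbiel.even_anticomm (hZ : IsZinbiel Z) (F : FreeMagma X →ₙ* Z)
    (hF : ∀ x y, F (.of x) * F (.of y) + F (.of y) * F (.of x) = 0) {a : FreeMagma X}
    (ha : Even a.length) (x y : X) :
    F a * F (.of x) * F (.of y) + F a * F (.of y) * F (.of x) = 0 := by
  have e₁ := (hZ.parity F hF (.of x) a odd_one).1 ha
  have e₂ := (hZ.parity F hF (.of y) a odd_one).1 ha
  have e : F a * (F (.of x) * F (.of y) + F (.of y) * F (.of x)) = 0 := by rw [hF, mul_zero]
  rw [mul_add, hZ, hZ, e₁, e₂] at e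
  simpa using e

end Zinbiel

/-! ### The envelope of an algebra with zero multiplication -/

section Presentation

variable {k : Type*} [Field k] {X : Type*}

/-- The projection onto the quotient algebra as a homomorphism. -/
def AlgQuot.mkHom {M : Type*} [NonUnitalNonAssocRing M] [Module k M] (S : Set M) :
    M →ₙₐ[k] AlgQuot k S where
  toFun := AlgQuot.mk k S
  map_smul' := map_smul _
  map_zero' := map_zero _
  map_add' := map_add _
  map_mul' := AlgQuot.mk_mul k

theorem lift_word_of {Z : Type*} [NonUnitalNonAssocRing Z] [Module k Z] [IsScalarTower k Z Z]
    [SMulCommClass k Z Z] (g : X → Z) (x : X) :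
    FreeNonUnitalNonAssocAlgebra.lift k g (word k (.of x)) = g x :=
  FreeNonUnitalNonAssocAlgebra.lift_of_apply k g x

theorem mem_span_range_word (f : FreeNonUnitalNonAssocAlgebra k X) :
    f ∈ Submodule.span k (Set.range (word (X := X) k)) := by
  rw [← Set.image_univ, mem_span_word]
  exact fun _ _ => Set.mem_univ _

/-- Homomorphisms to Zinbiel algebras that send the letters to anticommuting elements factor
through the relations. -/
theorem lift_eq_zero_of_zeroMulRel [LT X] {Z : Type*} [NonUnitalNonAssocRing Z] [Module k Z]
    [IsScalarTower k Z Z] [SMulCommClass k Z Z] (hk : (2 : k) ≠ 0) (hZ : IsZinbiel Z) {g : X → Z}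
    (hg : ∀ x y, g x * g y + g y * g x = 0) {f : FreeNonUnitalNonAssocAlgebra k X}
    (hf : ZeroMulRel k X f) : FreeNonUnitalNonAssocAlgebra.lift k g f = 0 := by
  -- Anticommutation at `x = y` gives only twice the square relations; this is where characteristic
  -- 2 is excluded.
  have half {z : Z} (hz : z + z = 0) : z = 0 := by
    rw [← two_smul k] at hz
    exact (smul_eq_zero_iff_right hk).1 hz
  let L := FreeNonUnitalNonAssocAlgebra.lift k g
  have hL (x : X) : L (word k (.of x)) = g x := lift_word_of g x
  have heven {a : FreeMagma X} (ha : Even a.length) (x y : X) :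
      L (word k a) * g x * g y + L (word k a) * g y * g x = 0 := by
    let F : FreeMagma X →ₙ* Z :=
      (L : _ →ₙ* Z).comp (MonoidAlgebra.ofMagma k (FreeMagma X))
    have hF (x : X) : F (.of x) = g x := hL x
    have := hZ.even_anticomm F (fun x y => by rw [hF, hF, hg]) ha x y
    rwa [hF, hF] at this
  change L f = 0
  cases hf with
  | zinbiel a b c =>
    simp only [word_mul, map_sub, map_mul]
    rw [hZ (L (word k a)), sub_sub, sub_self]
  | anticomm x y => simp only [word_mul, map_add, map_mul, hL, hg]
  | square x =>
    rw [word_mul, map_mul, hL]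
    exact half (hg x x)
  | evenAnticomm a x y ha => simp only [word_mul, map_add, map_mul, hL, heven ha]
  | evenSquare a x ha =>
    simp only [word_mul, map_mul, hL]
    exact half (heven ha x x)

/-- `S` contains the Zinbiel identity only for words; trilinearity extends it to all elements. -/
theorem isZinbiel_algQuot_zeroMulRel [LT X] : IsZinbiel (AlgQuot k {f | ZeroMulRel k X f}) := by
  let q := AlgQuot.mk k {f | ZeroMulRel k X f}
  have hword (a b c : FreeMagma X) : q (word k a) * (q (word k b) * q (word k c)) -
      q (word k a) * q (word k b) * q (word k c) - q (word k b) * q (word k a) * q (word k c)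
        = 0 := by
    simp only [q, ← AlgQuot.mk_mul, ← word_mul, ← map_sub]
    exact (AlgQuot.mk_eq_zero k).2 (subset_idealSpan k _ (.zinbiel a b c))
  suffices h : ∀ f g h : FreeNonUnitalNonAssocAlgebra k X,
      q f * (q g * q h) - q f * q g * q h - q g * q f * q h = 0 by
    intro a b c
    obtain ⟨a, rfl⟩ := AlgQuot.mk_surjective k a
    obtain ⟨b, rfl⟩ := AlgQuot.mk_surjective k b
    obtain ⟨c, rfl⟩ := AlgQuot.mk_surjective k c
    rw [← sub_eq_zero, ← sub_sub]
    exact h a b c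
  intro f g h
  induction mem_span_range_word f using Submodule.span_induction with
  | zero => simp
  | add f f' _ _ hf hf' =>
    rw [← add_zero (0 : AlgQuot k _)]
    nth_rw 1 [← hf]
    rw [← hf', map_add]
    simp only [add_mul, mul_add]
    abel
  | smul c f _ hf =>
    simp only [map_smul, smul_mul_assoc, mul_smul_comm, ← smul_sub, hf, smul_zero]
  | mem f hf =>
  obtain ⟨a, rfl⟩ := hf
  induction mem_span_range_word g using Submodule.span_induction with
  | zero => simp
  | add f f' _ _ hf hf' =>
    rw [← add_zero (0 : AlgQuot k _)]
    nth_rw 1 [← hf]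
    rw [← hf', map_add]
    simp only [add_mul, mul_add]
    abel
  | smul c f _ hf =>
    simp only [map_smul, smul_mul_assoc, mul_smul_comm, ← smul_sub, hf, smul_zero]
  | mem g hg =>
  obtain ⟨b, rfl⟩ := hg
  induction mem_span_range_word h using Submodule.span_induction with
  | zero => simp
  | add f f' _ _ hf hf' =>
    rw [← add_zero (0 : AlgQuot k _)]
    nth_rw 1 [← hf]
    rw [← hf', map_add]
    simp only [mul_add]
    abel
  | smul c f _ hf =>
    simp only [map_smul, mul_smul_comm, ← smul_sub, hf, smul_zero]
  | mem h hh =>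
  obtain ⟨c, rfl⟩ := hh
  exact hword a b c

theorem algQuot_zeroMulRel_anticomm [LinearOrder X] (x y : X) :
    AlgQuot.mk k {f | ZeroMulRel k X f} (word k (.of x)) * AlgQuot.mk k _ (word k (.of y)) +
      AlgQuot.mk k _ (word k (.of y)) * AlgQuot.mk k _ (word k (.of x)) = 0 := by
  simp only [← AlgQuot.mk_mul, ← word_mul]
  rcases lt_trichotomy x y with h | rfl | h
  · rw [← map_add]
    exact (AlgQuot.mk_eq_zero k).2 (subset_idealSpan k _ (.anticomm x y h))
  · rw [(AlgQuot.mk_eq_zero k).2 (subset_idealSpan k _ (.square x)), add_zero]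
  · rw [add_comm, ← map_add]
    exact (AlgQuot.mk_eq_zero k).2 (subset_idealSpan k _ (.anticomm y x h))

/-! ### Surjectivity and kernel of the map onto the envelope -/

variable {A : Type*} [NonUnitalCommRing A] [Module k A]

theorem lift_envelope_surjective (e : Module.Basis X k A) : Function.Surjective
    (FreeNonUnitalNonAssocAlgebra.lift k fun x : X => Envelope.ι k A (e x)) := by
  let L := FreeNonUnitalNonAssocAlgebra.lift k fun x : X => Envelope.ι k A (e x)
  have hι (a : A) : Envelope.ι k A a ∈
      LinearMap.range (L : FreeNonUnitalNonAssocAlgebra k X →ₗ[k] Envelope k A) := by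
    induction e.mem_span a using Submodule.span_induction with
    | mem a ha =>
      obtain ⟨x, rfl⟩ := ha
      exact ⟨word k (.of x), lift_word_of _ x⟩
    | zero => rw [map_zero]; exact zero_mem _
    | add a b _ _ ha hb => rw [map_add]; exact add_mem ha hb
    | smul c a _ ha => rw [map_smul]; exact Submodule.smul_mem _ c ha
  intro z
  obtain ⟨f, rfl⟩ := AlgQuot.mk_surjective k z
  change AlgQuot.mk k _ f ∈
    LinearMap.range (L : FreeNonUnitalNonAssocAlgebra k X →ₗ[k] Envelope k A)
  induction mem_span_range_word f using Submodule.span_induction with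
  | zero => rw [map_zero]; exact zero_mem _
  | add f g _ _ hf hg => rw [map_add]; exact add_mem hf hg
  | smul c f _ hf => rw [map_smul]; exact Submodule.smul_mem _ c hf
  | mem f hf =>
    obtain ⟨w, rfl⟩ := hf
    induction w with
    | ih1 a => exact hι a
    | ih2 u v hu hv =>
      obtain ⟨f, hf⟩ := hu
      obtain ⟨g, hg⟩ := hv
      refine ⟨f * g, ?_⟩
      rw [word_mul, AlgQuot.mk_mul, ← hf, ← hg]
      exact map_mul L f g

/-- The universal property yields `ψ` from the envelope to `M⟨X⟩ / I(S)` whose composite with the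
lift fixes the letters. The composite is thus the projection, and the kernel of the lift lies in
`I(S)`. The other inclusion holds because the lift kills `S`. -/
theorem lift_envelope_eq_zero_iff [LinearOrder X] (hA : ∀ a b : A, a * b = 0)
    (hk : (2 : k) ≠ 0) (e : Module.Basis X k A) (f : FreeNonUnitalNonAssocAlgebra k X) :
    FreeNonUnitalNonAssocAlgebra.lift k (fun x : X => Envelope.ι k A (e x)) f = 0 ↔
      f ∈ idealSpan k {f | ZeroMulRel k X f} := by
  let L := FreeNonUnitalNonAssocAlgebra.lift k fun x : X => Envelope.ι k A (e x)
  constructor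
  · intro hf
    let q : X → AlgQuot k {f | ZeroMulRel k X f} := fun x => AlgQuot.mk k _ (word k (.of x))
    -- As `A` has zero product, this bilinear extension from the basis says that `e.constr k q` is a
    -- homomorphism to the quotient with the product `ab + ba`.
    have hq (a b : A) : e.constr k q a * e.constr k q b + e.constr k q b * e.constr k q a = 0 := by
      induction e.mem_span a using Submodule.span_induction with
      | zero => simp
      | add a a' _ _ ha ha' =>
        rw [← add_zero (0 : AlgQuot k _)]
        nth_rw 1 [← ha]
        rw [← ha', map_add]
        simp only [add_mul, mul_add]
        abel
      | smul c a _ ha => rw [map_smul, smul_mul_assoc, mul_smul_comm, ← smul_add, ha, smul_zero]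
      | mem a ha =>
      obtain ⟨x, rfl⟩ := ha
      induction e.mem_span b using Submodule.span_induction with
      | zero => simp
      | add b b' _ _ hb hb' =>
        rw [← add_zero (0 : AlgQuot k _)]
        nth_rw 1 [← hb]
        rw [← hb', map_add]
        simp only [add_mul, mul_add]
        abel
      | smul c b _ hb => rw [map_smul, smul_mul_assoc, mul_smul_comm, ← smul_add, hb, smul_zero]
      | mem b hb =>
      obtain ⟨y, rfl⟩ := hb
      rw [e.constr_basis, e.constr_basis]
      exact algQuot_zeroMulRel_anticomm x y
    obtain ⟨ψ, hψ, -⟩ := Envelope.existsUnique_lift k A isZinbiel_algQuot_zeroMulRel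
      (e.constr k q) fun a b => by rw [hA, map_zero, hq]
    have hcomp : ψ.comp L = AlgQuot.mkHom {f | ZeroMulRel k X f} := by
      refine FreeNonUnitalNonAssocAlgebra.hom_ext k fun x => ?_
      change ψ (L (word k (.of x))) = q x
      rw [lift_word_of, hψ, e.constr_basis]
    refine (AlgQuot.mk_eq_zero k).1 ?_
    have := DFunLike.congr_fun hcomp f
    exact this.symm.trans ((congrArg ψ hf).trans (map_zero ψ))
  · intro hf
    refine (idealSpan_le k ?_ ?_ : _ ≤ LinearMap.ker
      (L : FreeNonUnitalNonAssocAlgebra k X →ₗ[k] Envelope k A)) hf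
    · intro s hs
      refine lift_eq_zero_of_zeroMulRel hk (Envelope.isZinbiel k A) (fun x y => ?_) hs
      rw [← Envelope.ι_mul, hA, map_zero]
    · intro a f hf
      have hf : L f = 0 := hf
      change L (a * f) = 0 ∧ L (f * a) = 0
      rw [map_mul, map_mul, hf, mul_zero, zero_mul]
      exact ⟨rfl, rfl⟩

end Presentation

end PreCom

end

theorem mainTheorem4 {k : Type*} [Field k] {A : Type*} [NonUnitalCommRing A] [Module k A]
    [IsScalarTower k A A] [SMulCommClass k A A] (hA : ∀ a b : A, a * b = 0)
    {X : Type*} [LinearOrder X] [WellFoundedLT X] (e : Module.Basis X k A) :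
    PreCom.IsGSB {f | PreCom.ZeroMulRel k X f} ∧
    ((2 : k) ≠ 0 →
      Function.Surjective
        (FreeNonUnitalNonAssocAlgebra.lift k fun x : X => PreCom.Envelope.ι k A (e x)) ∧
      ∀ f : FreeNonUnitalNonAssocAlgebra k X,
        FreeNonUnitalNonAssocAlgebra.lift k (fun x : X => PreCom.Envelope.ι k A (e x)) f = 0 ↔
          f ∈ PreCom.idealSpan k {f | PreCom.ZeroMulRel k X f}) := by
  exact ⟨PreCom.isGSB_zeroMulRel k X, fun hk =>
    ⟨PreCom.lift_envelope_surjective e, PreCom.lift_envelope_eq_zero_iff hA hk e⟩⟩
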